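/- Let $\mathbb{F}_2$ be the field with two elements. A polynomial $f$ is called self-reciprocal if $f^*=f$, where $f^*(x)=x^{\deg f}f(1/x)$. For $n\ge 1$ and $a\in\mathbb{F}_2$ let $S_2(n;a)$ denote the number of self-reciprocal irreducible monic polynomials $f$ of degree $2n$ over $\mathbb{F}_2$ whose coefficient of $x^{2n-1}$ equals $a$. Let $\theta=\arccos\left(\frac{1}{2\sqrt{2}}\right)$ and let $\mu$ be the Möbius function. Then, for every integer $n\ge 1$, $$S_2(n;1)=\frac{1}{4n}\sum_{\substack{j\mid n\\ j\text{ odd}}}\mu(j)\left(2^{n/j}+1-(-1)^{n/j}\,2^{\frac{n}{2j}+1}\cos\left(\frac{n\theta}{j}\right)\right),$$ $$S_2(n;0)=\frac{1}{4n}\sum_{\substack{j\mid n\\ j\text{ odd}}}\mu(j)\left(2^{n/j}-1+(-1)^{n/j}\,2^{\frac{n}{2j}+1}\cos\left(\frac{n\theta}{j}\right)\right).$$ -/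

import Mathlib

open Polynomial

/-- The monic irreducible polynomials `f` over `F` of degree `d` that are self-reciprocal, i.e.
`f = f^*` where `f^*(x) = x^(deg f) f(1/x)`. -/
def selfRecipIrred (F : Type*) [Field F] (d : ℕ) : Set F[X] :=
  {f | f.Monic ∧ Irreducible f ∧ f.reverse = f ∧ f.natDegree = d}

/-- The members of `selfRecipIrred F d` with `ℓ` prescribed leading coefficients: the coefficient
of `x^(d-j)` is `a_j` for `1 ≤ j ≤ ℓ` (`a_j` is `a i` with `j = i + 1`; a coefficient at a
negative exponent is `0`). -/
def selfRecipIrredLead (F : Type*) [Field F] (d : ℕ) {ℓ : ℕ} (a : Fin ℓ → F) : Set F[X] :=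
  {f | f ∈ selfRecipIrred F d ∧
    ∀ i : Fin ℓ, (if (i : ℕ) + 1 ≤ d then f.coeff (d - ((i : ℕ) + 1)) else 0) = a i}

/-- `S_F(n; a)`: the number of self-reciprocal irreducible monic polynomials of degree `2n` over
`F` with prescribed leading coefficients `a`. -/
noncomputable def numSelfRecip (F : Type*) [Field F] (n : ℕ) {ℓ : ℕ} (a : Fin ℓ → F) : ℕ :=
  (selfRecipIrredLead F (2 * n) a).ncard

/-- Over a finite field the set being counted is finite, so that `numSelfRecip` is its genuine
cardinality. -/
theorem selfRecipIrredLead_finite (F : Type*) [Field F] [Finite F] (d : ℕ) {ℓ : ℕ}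
    (a : Fin ℓ → F) : (selfRecipIrredLead F d a).Finite := by
  have h : Set.InjOn (fun (f : F[X]) (i : Fin (d + 1)) => f.coeff i)
      (selfRecipIrredLead F d a) := by
    intro f hf g hg hfg
    ext k
    by_cases hk : k < d + 1
    · exact congrFun hfg ⟨k, hk⟩
    · rw [coeff_eq_zero_of_natDegree_lt (by have := hf.1.2.2.2; omega),
        coeff_eq_zero_of_natDegree_lt (by have := hg.1.2.2.2; omega)]
  exact Set.Finite.of_finite_image (Set.toFinite _) h

/-!
A self-reciprocal polynomial of degree `2n` is `x ^ n * g (x + 1 / x)` for a unique `g` of degree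
`n`, and this lift of `g` has the same second coefficient as `g`. It is irreducible exactly when `g`
is and `x + 1 / x = α` has no solution in `𝔽₂(α)`, where `α` is a root of `g`. In characteristic two
this equation is equivalent to the Artin-Schreier equation `u ^ 2 - u = 1 / α`, so the condition is
`Tr (1 / α) ≠ 0`, where `Tr (1 / α)` is, up to sign, the quotient `g₁ / g₀` of coefficients of `g`.

It remains to count irreducible `g` with prescribed sums of the roots and of their inverses. By
orthogonality this is a matter of the prime power sums of the characters
`g ↦ ψ (u * g_{n-1} + v * g₁ / g₀)`. For `u, v ≠ 0` the L-series of such a character is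
`1 + K T + q T ^ 2` with `K` a Kloosterman sum. Over `𝔽₂` this is `1 + T + 2 T ^ 2`, with reciprocal
roots `-√2 * exp (± i θ)`. Even powers of `g` have vanishing coefficient quotient and drop out, so a
Möbius inversion over odd divisors extracts the irreducible polynomials.
-/

open scoped Finset PowerSeries

/-! ### Monic polynomials over a finite field -/

theorem finite_setOf_monic_natDegree_eq (F : Type*) [Field F] [Finite F] (n : ℕ) :
    {f : F[X] | f.Monic ∧ f.natDegree = n}.Finite := by
  have : Finite (degreeLT F (n + 1)) := Finite.of_equiv _ (degreeLTEquiv F (n + 1)).symm.toEquiv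
  refine (Set.toFinite (degreeLT F (n + 1) : Set F[X])).subset fun f hf => ?_
  rw [SetLike.mem_coe, mem_degreeLT]
  exact degree_le_natDegree.trans_lt (by exact_mod_cast hf.2.trans_lt n.lt_succ_self)

/-- The finite set of monic polynomials of degree `n` over the finite field `F`. -/
noncomputable def monicsOfDegree (F : Type*) [Field F] [Finite F] (n : ℕ) : Finset F[X] :=
  (finite_setOf_monic_natDegree_eq F n).toFinset

open Classical in
/-- The finite set of monic irreducible polynomials of degree `n` over the finite field `F`. -/
noncomputable def irreduciblesOfDegree (F : Type*) [Field F] [Finite F] (n : ℕ) : Finset F[X] :=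
  {f ∈ monicsOfDegree F n | Irreducible f}

section Monics

open UniqueFactorizationMonoid

variable {F : Type*} [Field F]

@[simp]
theorem mem_monicsOfDegree [Finite F] {n : ℕ} {f : F[X]} :
    f ∈ monicsOfDegree F n ↔ f.Monic ∧ f.natDegree = n := by
  simp [monicsOfDegree]

@[simp]
theorem mem_irreduciblesOfDegree [Finite F] {n : ℕ} {f : F[X]} :
    f ∈ irreduciblesOfDegree F n ↔ (f.Monic ∧ f.natDegree = n) ∧ Irreducible f := by
  simp [irreduciblesOfDegree]

theorem monicsOfDegree_zero [Finite F] : monicsOfDegree F 0 = {1} := by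
  ext f
  rw [mem_monicsOfDegree, Finset.mem_singleton]
  exact ⟨fun h => h.1.natDegree_eq_zero.1 h.2, by rintro rfl; simp⟩

theorem monic_X_mul_add_C {g : F[X]} (hg : g.Monic) (b : F) : (X * g + C b).Monic :=
  (monic_X.mul hg).add_of_left <| degree_C_le.trans_lt <| by
    rw [← natDegree_pos_iff_degree_pos, natDegree_X_mul hg.ne_zero]
    exact Nat.succ_pos _

theorem natDegree_X_mul_add_C {g : F[X]} (hg : g ≠ 0) (b : F) :
    (X * g + C b).natDegree = g.natDegree + 1 := by
  rw [natDegree_add_C, natDegree_X_mul hg]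

theorem sum_monicsOfDegree_succ [Fintype F] {M : Type*} [AddCommMonoid M] (n : ℕ)
    (φ : F[X] → M) :
    ∑ f ∈ monicsOfDegree F (n + 1), φ f =
      ∑ b : F, ∑ g ∈ monicsOfDegree F n, φ (X * g + C b) := by
  rw [← Finset.sum_product']
  refine (Finset.sum_bij (fun x _ => X * x.2 + C x.1) ?_ ?_ ?_ fun _ _ => rfl).symm
  · rintro ⟨b, g⟩ hg
    simp only [Finset.mem_product, Finset.mem_univ, true_and, mem_monicsOfDegree] at hg
    rw [mem_monicsOfDegree, natDegree_X_mul_add_C hg.1.ne_zero, hg.2]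
    exact ⟨monic_X_mul_add_C hg.1 b, rfl⟩
  · rintro ⟨b, g⟩ _ ⟨c, h⟩ _ hbc
    obtain rfl : b = c := by simpa using congrArg (coeff · 0) hbc
    simpa using hbc
  · intro f hf
    obtain ⟨hm, hd⟩ := mem_monicsOfDegree.1 hf
    have hdiv : f.divX.natDegree = n := by
      rw [natDegree_divX_eq_natDegree_tsub_one, hd, Nat.add_sub_cancel]
    have hmon : f.divX.Monic := by
      rwa [Monic, leadingCoeff, hdiv, coeff_divX, ← hd]
    exact ⟨(f.coeff 0, f.divX), by simp [hmon, hdiv], X_mul_divX_add f⟩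

theorem card_monicsOfDegree [Fintype F] (n : ℕ) :
    (monicsOfDegree F n).card = Fintype.card F ^ n := by
  induction n with
  | zero => simp [monicsOfDegree_zero]
  | succ n ih =>
    rw [Finset.card_eq_sum_ones, sum_monicsOfDegree_succ]
    simp [ih, pow_succ, mul_comm]

theorem pow_dvd_iff_le_count_normalizedFactors [DecidableEq F] {P f : F[X]} (hP : P.Monic)
    (hPi : Irreducible P) (hf : f ≠ 0) (m : ℕ) :
    P ^ m ∣ f ↔ m ≤ (normalizedFactors f).count P := by
  rw [pow_dvd_iff_le_emultiplicity, emultiplicity_eq_count_normalizedFactors hPi hf,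
    hP.normalize_eq_self, Nat.cast_le]

theorem monic_of_mem_normalizedFactors [DecidableEq F] {P f : F[X]}
    (hP : P ∈ normalizedFactors f) : P.Monic := by
  rw [← normalize_normalized_factor P hP]
  exact monic_normalize (irreducible_of_normalized_factor P hP).ne_zero

theorem sum_natDegree_normalizedFactors [DecidableEq F] {f : F[X]} (hf : f.Monic) :
    ((normalizedFactors f).map natDegree).sum = f.natDegree := by
  rw [← natDegree_multiset_prod_of_monic _ fun P => monic_of_mem_normalizedFactors,
    prod_normalizedFactors_eq hf.ne_zero, hf.normalize_eq_self]

open Classical in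
theorem card_multiples_natDegree_pow_dvd {P f : F[X]} (hP : P.Monic) (hPi : Irreducible P)
    (hf : f ≠ 0) :
    #{k ∈ Finset.range (f.natDegree + 1) | P.natDegree ∈ k.divisors ∧ P ^ (k / P.natDegree) ∣ f} =
      (normalizedFactors f).count P := by
  set c := (normalizedFactors f).count P
  have hpos : 0 < P.natDegree := hPi.natDegree_pos
  have hdvd := pow_dvd_iff_le_count_normalizedFactors hP hPi hf
  have hle : ∀ m ≤ c, P.natDegree * m ≤ f.natDegree := fun m hm => by
    rw [mul_comm, ← hP.natDegree_pow]
    exact natDegree_le_of_dvd ((hdvd m).2 hm) hf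
  have himage : {k ∈ Finset.range (f.natDegree + 1) |
      P.natDegree ∈ k.divisors ∧ P ^ (k / P.natDegree) ∣ f} =
      (Finset.Icc 1 c).image (P.natDegree * ·) := by
    ext k
    simp only [Finset.mem_filter, Finset.mem_range, Nat.mem_divisors, Finset.mem_image,
      Finset.mem_Icc, hdvd]
    constructor
    · rintro ⟨-, ⟨⟨m, rfl⟩, h0⟩, hm⟩
      rw [Nat.mul_div_cancel_left _ hpos] at hm
      exact ⟨m, ⟨Nat.pos_of_ne_zero (right_ne_zero_of_mul h0), hm⟩, rfl⟩
    · rintro ⟨m, ⟨h1, hm⟩, rfl⟩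
      rw [Nat.mul_div_cancel_left _ hpos]
      exact ⟨Nat.lt_succ_of_le (hle m hm), ⟨dvd_mul_right _ _, (Nat.mul_pos hpos h1).ne'⟩, hm⟩
  rw [himage, Finset.card_image_of_injective _ (mul_right_injective₀ hpos.ne'),
    Nat.card_Icc, Nat.add_sub_cancel]

open Classical in
theorem filter_pow_dvd_irreduciblesOfDegree [Finite F] {f : F[X]} (hf : f ≠ 0) {d m : ℕ}
    (hm : m ≠ 0) :
    {P ∈ irreduciblesOfDegree F d | P ^ m ∣ f} =
      {P ∈ (normalizedFactors f).toFinset | P.natDegree = d ∧ P ^ m ∣ f} := by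
  ext P
  simp only [Finset.mem_filter, mem_irreduciblesOfDegree, Multiset.mem_toFinset]
  constructor
  · rintro ⟨⟨⟨hP, hd⟩, hPi⟩, hdvd⟩
    refine ⟨?_, hd, hdvd⟩
    rw [← Multiset.count_pos]
    exact (Nat.pos_of_ne_zero hm).trans_le
      ((pow_dvd_iff_le_count_normalizedFactors hP hPi hf m).1 hdvd)
  · rintro ⟨hP, hd, hdvd⟩
    exact ⟨⟨⟨monic_of_mem_normalizedFactors hP, hd⟩, irreducible_of_normalized_factor P hP⟩, hdvd⟩

open Classical in
theorem sum_mul_card_pow_dvd_eq_natDegree [Finite F] {f : F[X]} (hf : f.Monic) :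
    ∑ k ∈ Finset.range (f.natDegree + 1), ∑ d ∈ k.divisors,
      d * #{P ∈ irreduciblesOfDegree F d | P ^ (k / d) ∣ f} = f.natDegree := by
  set s := normalizedFactors f
  have hfiber : ∀ k, ∑ d ∈ k.divisors, d * #{P ∈ irreduciblesOfDegree F d | P ^ (k / d) ∣ f} =
      ∑ P ∈ s.toFinset with P.natDegree ∈ k.divisors ∧ P ^ (k / P.natDegree) ∣ f,
        P.natDegree := by
    intro k
    rw [← Finset.sum_fiberwise_of_maps_to (t := k.divisors) (g := natDegree)
      fun P hP => (Finset.mem_filter.1 hP).2.1]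
    refine Finset.sum_congr rfl fun d hd => ?_
    have hkd : k / d ≠ 0 :=
      (Nat.div_pos (Nat.divisor_le hd) (Nat.pos_of_mem_divisors hd)).ne'
    rw [filter_pow_dvd_irreduciblesOfDegree hf.ne_zero hkd, Finset.filter_filter,
      Finset.sum_congr rfl fun P hP => (Finset.mem_filter.1 hP).2.2, Finset.sum_const,
      smul_eq_mul, mul_comm]
    congr 2
    refine Finset.filter_congr fun P _ => ⟨?_, ?_⟩
    · rintro ⟨rfl, hdvd⟩
      exact ⟨⟨hd, hdvd⟩, rfl⟩
    · rintro ⟨⟨-, hdvd⟩, rfl⟩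
      exact ⟨rfl, hdvd⟩
  calc _ = ∑ P ∈ s.toFinset, ∑ k ∈ Finset.range (f.natDegree + 1) with
          P.natDegree ∈ k.divisors ∧ P ^ (k / P.natDegree) ∣ f, P.natDegree := by
        simp_rw [hfiber]
        exact Finset.sum_comm' fun k P => by simp only [Finset.mem_filter]; tauto
    _ = ∑ P ∈ s.toFinset, s.count P * P.natDegree := by
        refine Finset.sum_congr rfl fun P hP => ?_
        have hP := Multiset.mem_toFinset.1 hP
        rw [Finset.sum_const, smul_eq_mul, card_multiples_natDegree_pow_dvd
          (monic_of_mem_normalizedFactors hP)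
          (irreducible_of_normalized_factor P hP) hf.ne_zero]
    _ = (s.map natDegree).sum := by simp only [Finset.sum_multiset_map_count, smul_eq_mul]
    _ = f.natDegree := sum_natDegree_normalizedFactors hf

end Monics

/-! ### Logarithmic derivatives of power series -/

/-- `P` is the logarithmic derivative `T L' / L` of the power series `L`, stated without
division. -/
def IsLogDeriv {R : Type*} [CommRing R] (L P : R⟦X⟧) : Prop :=
  PowerSeries.X * PowerSeries.derivative R L = P * L

namespace IsLogDeriv

variable {R : Type*} [CommRing R] {L M P Q : R⟦X⟧}

theorem mul (hL : IsLogDeriv L P) (hM : IsLogDeriv M Q) : IsLogDeriv (L * M) (P + Q) := by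
  unfold IsLogDeriv at *
  rw [Derivation.leibniz, smul_eq_mul, smul_eq_mul]
  linear_combination M * hL + L * hM

theorem one_sub_C_mul_X (α : R) :
    IsLogDeriv (1 - PowerSeries.C α * PowerSeries.X) (1 - PowerSeries.mk (α ^ ·)) := by
  have hgeom : PowerSeries.mk (α ^ ·) * (1 - PowerSeries.C α * PowerSeries.X) = 1 := by
    ext n
    cases n with
    | zero => simp [mul_sub]
    | succ n =>
      simp only [mul_sub, mul_one, mul_left_comm _ (PowerSeries.C α), map_sub,
        PowerSeries.coeff_C_mul, PowerSeries.coeff_succ_mul_X, PowerSeries.coeff_mk,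
        PowerSeries.coeff_one, Nat.succ_ne_zero, if_false, pow_succ', sub_self]
  rw [IsLogDeriv, sub_mul, hgeom, map_sub, PowerSeries.derivative_one, Derivation.leibniz,
    PowerSeries.derivative_C, PowerSeries.derivative_X, smul_zero, add_zero, smul_eq_mul]
  ring

theorem unique [IsDomain R] (hP : IsLogDeriv L P) (hQ : IsLogDeriv L Q) (hL : L ≠ 0) : P = Q :=
  mul_right_cancel₀ hL (hP.symm.trans hQ)

end IsLogDeriv

theorem one_sub_C_mul_X_ne_zero {R : Type*} [CommRing R] [Nontrivial R] (α : R) :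
    (1 - PowerSeries.C α * PowerSeries.X : R⟦X⟧) ≠ 0 := fun h => by
  simpa using congrArg PowerSeries.constantCoeff h

/-! ### Multiplicative functions on monic polynomials -/

/-- A function on polynomials that is completely multiplicative on the monic ones. -/
structure IsMonicCharacter {F R : Type*} [Field F] [CommRing R] (χ : F[X] → R) : Prop where
  map_one : χ 1 = 1
  map_mul : ∀ {f g : F[X]}, f.Monic → g.Monic → χ (f * g) = χ f * χ g

/-- The sum of `χ` over the monic polynomials of degree `n`. -/
noncomputable def monicSum {F R : Type*} [Field F] [Finite F] [CommRing R] (χ : F[X] → R)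
    (n : ℕ) : R :=
  ∑ f ∈ monicsOfDegree F n, χ f

/-- The L-series `∑ χ f T ^ deg f` of `χ`, the sum ranging over monic polynomials `f`. -/
noncomputable def monicSeries {F R : Type*} [Field F] [Finite F] [CommRing R] (χ : F[X] → R) :
    R⟦X⟧ :=
  PowerSeries.mk (monicSum χ)

/-- The sum of `deg P * χ P ^ m` over the powers `P ^ m` of degree `k` of monic irreducible
polynomials `P`. There are none when `k = 0`. -/
noncomputable def primePowerSum {F R : Type*} [Field F] [Finite F] [CommRing R] (χ : F[X] → R)
    (k : ℕ) : R :=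
  ∑ d ∈ k.divisors, d * ∑ P ∈ irreduciblesOfDegree F d, χ P ^ (k / d)

namespace IsMonicCharacter

variable {F R : Type*} [Field F] [CommRing R] {χ : F[X] → R}

theorem map_pow (hχ : IsMonicCharacter χ) {f : F[X]} (hf : f.Monic) (n : ℕ) :
    χ (f ^ n) = χ f ^ n := by
  induction n with
  | zero => rw [pow_zero, pow_zero, hχ.map_one]
  | succ n ih => rw [pow_succ, hχ.map_mul (hf.pow n) hf, ih, pow_succ]

variable [Finite F]

theorem monicSum_zero (hχ : IsMonicCharacter χ) : monicSum χ 0 = 1 := by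
  rw [monicSum, monicsOfDegree_zero, Finset.sum_singleton, hχ.map_one]

open Classical in
theorem sum_filter_dvd (hχ : IsMonicCharacter χ) {Q : F[X]} (hQ : Q.Monic) (l : ℕ) :
    ∑ f ∈ monicsOfDegree F (Q.natDegree + l) with Q ∣ f, χ f = χ Q * monicSum χ l := by
  rw [monicSum, Finset.mul_sum]
  refine (Finset.sum_bij (fun g _ => Q * g) ?_ (fun g _ g' _ h => mul_left_cancel₀ hQ.ne_zero h)
    ?_ fun g hg => (hχ.map_mul hQ (mem_monicsOfDegree.1 hg).1).symm).symm
  · intro g hg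
    obtain ⟨hm, hd⟩ := mem_monicsOfDegree.1 hg
    rw [Finset.mem_filter, mem_monicsOfDegree, hQ.natDegree_mul hm, hd]
    exact ⟨⟨hQ.mul hm, rfl⟩, dvd_mul_right _ _⟩
  · intro f hf
    obtain ⟨hf, g, rfl⟩ := Finset.mem_filter.1 hf
    obtain ⟨hm, hd⟩ := mem_monicsOfDegree.1 hf
    have hg : g.Monic := hQ.of_mul_monic_left hm
    rw [hQ.natDegree_mul hg, Nat.add_left_cancel_iff] at hd
    exact ⟨g, mem_monicsOfDegree.2 ⟨hg, hd⟩, rfl⟩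

open Classical in
theorem sum_irreduciblesOfDegree_pow_mul_monicSum (hχ : IsMonicCharacter χ) (d m l : ℕ) :
    (∑ P ∈ irreduciblesOfDegree F d, χ P ^ m) * monicSum χ l =
      ∑ f ∈ monicsOfDegree F (d * m + l), #{P ∈ irreduciblesOfDegree F d | P ^ m ∣ f} * χ f := by
  simp only [Finset.card_eq_sum_ones, Nat.cast_sum, Finset.sum_mul, Nat.cast_one, one_mul]
  rw [Finset.sum_comm' (t' := irreduciblesOfDegree F d)
    (s' := fun P => {f ∈ monicsOfDegree F (d * m + l) | P ^ m ∣ f})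
    fun f P => by simp only [Finset.mem_filter]; tauto]
  refine Finset.sum_congr rfl fun P hP => ?_
  obtain ⟨⟨hPm, rfl⟩, -⟩ := mem_irreduciblesOfDegree.1 hP
  rw [← hχ.map_pow hPm, ← hχ.sum_filter_dvd (hPm.pow m), hPm.natDegree_pow, mul_comm m]

-- Every monic `f` of degree `n` satisfies `n = ∑ deg P` over the prime powers `P ^ m` dividing `f`.
theorem mul_monicSum_eq_sum_antidiagonal (hχ : IsMonicCharacter χ) (n : ℕ) :
    n * monicSum χ n =
      ∑ x ∈ Finset.HasAntidiagonal.antidiagonal n, primePowerSum χ x.1 * monicSum χ x.2 := by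
  classical
  rw [Finset.Nat.sum_antidiagonal_eq_sum_range_succ fun k l => primePowerSum χ k * monicSum χ l]
  calc n * monicSum χ n
      = ∑ f ∈ monicsOfDegree F n, ∑ k ∈ Finset.range (n + 1), ∑ d ∈ k.divisors,
          d * (#{P ∈ irreduciblesOfDegree F d | P ^ (k / d) ∣ f} * χ f) := by
        rw [monicSum, Finset.mul_sum]
        refine Finset.sum_congr rfl fun f hf => ?_
        obtain ⟨hm, rfl⟩ := mem_monicsOfDegree.1 hf
        conv_lhs => rw [← sum_mul_card_pow_dvd_eq_natDegree hm]
        simp only [Nat.cast_sum, Nat.cast_mul, Finset.sum_mul, mul_assoc]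
    _ = ∑ k ∈ Finset.range (n + 1), primePowerSum χ k * monicSum χ (n - k) := by
        rw [Finset.sum_comm]
        refine Finset.sum_congr rfl fun k hk => ?_
        rw [Finset.sum_comm, primePowerSum, Finset.sum_mul]
        refine Finset.sum_congr rfl fun d hd => ?_
        have hn : d * (k / d) + (n - k) = n := by
          rw [Nat.mul_div_cancel' (Nat.dvd_of_mem_divisors hd)]
          exact Nat.add_sub_cancel' (Finset.mem_range_succ_iff.1 hk)
        rw [← Finset.mul_sum, mul_assoc, hχ.sum_irreduciblesOfDegree_pow_mul_monicSum, hn]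

theorem isLogDeriv_monicSeries (hχ : IsMonicCharacter χ) :
    IsLogDeriv (monicSeries χ) (PowerSeries.mk (primePowerSum χ)) := by
  ext n
  rw [PowerSeries.coeff_mul (φ := PowerSeries.mk _)]
  simp only [monicSeries, PowerSeries.coeff_mk]
  rw [← hχ.mul_monicSum_eq_sum_antidiagonal]
  cases n with
  | zero => simp
  | succ n =>
    rw [PowerSeries.coeff_succ_X_mul, PowerSeries.coeff_derivative, PowerSeries.coeff_mk, mul_comm,
      Nat.cast_succ]

theorem primePowerSum_of_eq_mul [IsDomain R] (hχ : IsMonicCharacter χ) {α β : R}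
    (h : monicSeries χ =
      (1 - PowerSeries.C α * PowerSeries.X) * (1 - PowerSeries.C β * PowerSeries.X))
    {k : ℕ} (hk : k ≠ 0) : primePowerSum χ k = -(α ^ k + β ^ k) := by
  have hlog := ((IsLogDeriv.one_sub_C_mul_X α).mul (IsLogDeriv.one_sub_C_mul_X β)).unique
    (h ▸ hχ.isLogDeriv_monicSeries)
    (mul_ne_zero (one_sub_C_mul_X_ne_zero α) (one_sub_C_mul_X_ne_zero β))
  have hcoeff := congrArg (PowerSeries.coeff k) hlog
  simp only [map_add, map_sub, PowerSeries.coeff_one, hk, if_false, PowerSeries.coeff_mk] at hcoeff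
  linear_combination -hcoeff

theorem primePowerSum_of_mul_eq [IsDomain R] (hχ : IsMonicCharacter χ) {α β : R}
    (h : monicSeries χ * (1 - PowerSeries.C β * PowerSeries.X) =
      1 - PowerSeries.C α * PowerSeries.X)
    {k : ℕ} (hk : k ≠ 0) : primePowerSum χ k = β ^ k - α ^ k := by
  have hlog := (IsLogDeriv.one_sub_C_mul_X α).unique
    (h ▸ hχ.isLogDeriv_monicSeries.mul (IsLogDeriv.one_sub_C_mul_X β)) (one_sub_C_mul_X_ne_zero α)
  have hcoeff := congrArg (PowerSeries.coeff k) hlog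
  simp only [map_add, map_sub, PowerSeries.coeff_one, hk, if_false, PowerSeries.coeff_mk] at hcoeff
  linear_combination -hcoeff

theorem monicSeries_eq_of_three_le (hχ : IsMonicCharacter χ)
    (h : ∀ n, 3 ≤ n → monicSum χ n = 0) :
    monicSeries χ = 1 + PowerSeries.C (monicSum χ 1) * PowerSeries.X +
      PowerSeries.C (monicSum χ 2) * PowerSeries.X ^ 2 := by
  ext n
  rw [monicSeries, PowerSeries.coeff_mk]
  match n with
  | 0 => simp [hχ.monicSum_zero]
  | 1 => simp [PowerSeries.coeff_one, PowerSeries.coeff_X_pow]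
  | 2 => simp [PowerSeries.coeff_one, PowerSeries.coeff_X_pow]
  | n + 3 => simp [h, PowerSeries.coeff_one, PowerSeries.coeff_X_pow]

theorem primePowerSum_eq_neg_one [IsDomain R] (hχ : IsMonicCharacter χ)
    (h₁ : monicSum χ 1 = -1) (h₂ : ∀ n, 2 ≤ n → monicSum χ n = 0) {k : ℕ} (hk : k ≠ 0) :
    primePowerSum χ k = -1 := by
  have hL : monicSeries χ = (1 - PowerSeries.C 1 * PowerSeries.X) *
      (1 - PowerSeries.C 0 * PowerSeries.X) := by
    rw [hχ.monicSeries_eq_of_three_le fun n hn => h₂ n (by omega), h₁, h₂ 2 le_rfl]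
    simp only [map_neg, map_zero]
    ring
  rw [hχ.primePowerSum_of_eq_mul hL hk, one_pow, zero_pow hk, add_zero]

end IsMonicCharacter

/-! ### Characters of Kloosterman type -/

section Kloosterman

variable {F R : Type*} [Field F] [CommRing R] (ψ : AddChar F R) (u v : F)

open Classical in
/-- The character `f ↦ ψ (u s + v t)`, for monic `f` prime to `X`, where `-s` and `-t` are the sums
of the roots of `f` and of their inverses. It is `0` on multiples of `X`. -/
noncomputable def kloostermanChar (f : F[X]) : R :=
  if f.coeff 0 = 0 then 0 else ψ (u * f.nextCoeff + v * (f.coeff 1 / f.coeff 0))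

theorem isMonicCharacter_kloostermanChar : IsMonicCharacter (kloostermanChar ψ u v) where
  map_one := by simp [kloostermanChar, nextCoeff, coeff_one]
  map_mul := by
    intro f g hf hg
    unfold kloostermanChar
    by_cases hf0 : f.coeff 0 = 0
    · simp [hf0]
    by_cases hg0 : g.coeff 0 = 0
    · simp [hg0]
    have hfg0 : (f * g).coeff 0 ≠ 0 := by rw [mul_coeff_zero]; exact mul_ne_zero hf0 hg0
    rw [if_neg hfg0, if_neg hf0, if_neg hg0, ← AddChar.map_add_eq_mul, hf.nextCoeff_mul hg,
      mul_coeff_zero, mul_coeff_one]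
    congr 1
    field_simp
    ring

theorem nextCoeff_X_mul_add_C {g : F[X]} (hg : 0 < g.natDegree) (b : F) :
    (X * g + C b).nextCoeff = g.nextCoeff := by
  have hd := natDegree_X_mul_add_C (ne_zero_of_natDegree_gt hg) b
  obtain ⟨m, hm⟩ := Nat.exists_eq_succ_of_ne_zero hg.ne'
  rw [nextCoeff_of_natDegree_pos (by omega), nextCoeff_of_natDegree_pos hg, hd, hm]
  simp

open Classical in
theorem kloostermanChar_X_mul_add_C {g : F[X]} (hg : 0 < g.natDegree) (b : F) :
    kloostermanChar ψ u v (X * g + C b) =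
      if b = 0 then 0 else ψ (u * g.nextCoeff + v * (g.coeff 0 / b)) := by
  simp [kloostermanChar, nextCoeff_X_mul_add_C hg]

theorem degree_C_mul_X_pow_lt_of_mem_monicsOfDegree [Finite F] {m n : ℕ} (hmn : m < n) (b : F)
    {f : F[X]} (hf : f ∈ monicsOfDegree F n) : (C b * X ^ m).degree < f.degree := by
  obtain ⟨hm, rfl⟩ := mem_monicsOfDegree.1 hf
  rw [degree_eq_natDegree hm.ne_zero]
  exact (degree_C_mul_X_pow_le m b).trans_lt (by exact_mod_cast hmn)

theorem add_C_mul_X_pow_mem_monicsOfDegree [Finite F] {m n : ℕ} (hmn : m < n) (b : F)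
    {f : F[X]} (hf : f ∈ monicsOfDegree F n) : f + C b * X ^ m ∈ monicsOfDegree F n := by
  have hlt := degree_C_mul_X_pow_lt_of_mem_monicsOfDegree hmn b hf
  obtain ⟨hm, hd⟩ := mem_monicsOfDegree.1 hf
  exact mem_monicsOfDegree.2
    ⟨hm.add_of_left hlt, by rw [natDegree_add_eq_left_of_degree_lt hlt, hd]⟩

theorem sum_monicsOfDegree_add_C_mul_X_pow [Finite F] {M : Type*} [AddCommMonoid M] {m n : ℕ}
    (hm : 0 < m) (hmn : m < n) (t : F → F) (φ : F[X] → M) :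
    ∑ f ∈ monicsOfDegree F n, φ (f + C (t (f.coeff 0)) * X ^ m) =
      ∑ f ∈ monicsOfDegree F n, φ f := by
  have hcoeff : ∀ (f : F[X]) (b : F), (f + C b * X ^ m).coeff 0 = f.coeff 0 := fun f b => by
    simp [coeff_X_pow, hm.ne]
  refine Finset.sum_bij' (fun f _ => f + C (t (f.coeff 0)) * X ^ m)
    (fun f _ => f + C (-t (f.coeff 0)) * X ^ m)
    (fun f => add_C_mul_X_pow_mem_monicsOfDegree hmn _)
    (fun f => add_C_mul_X_pow_mem_monicsOfDegree hmn _) (fun f _ => ?_) (fun f _ => ?_)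
    fun _ _ => rfl
  · rw [hcoeff, C_neg, neg_mul, add_neg_cancel_right]
  · rw [hcoeff, C_neg, neg_mul, neg_add_cancel_right]

theorem nextCoeff_add_C_mul_X_pow [Finite F] {m n : ℕ} (hmn : m < n) (b : F) {f : F[X]}
    (hf : f ∈ monicsOfDegree F n) :
    (f + C b * X ^ m).nextCoeff = f.nextCoeff + if n - 1 = m then b else 0 := by
  have hd := (mem_monicsOfDegree.1 hf).2
  have hd' := (mem_monicsOfDegree.1 (add_C_mul_X_pow_mem_monicsOfDegree hmn b hf)).2
  rw [nextCoeff_of_natDegree_pos (by omega), nextCoeff_of_natDegree_pos (by omega), hd', hd,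
    coeff_add, coeff_C_mul_X_pow]

theorem monicSum_eq_zero_of_translate [Finite F] [IsDomain R] {m n : ℕ} (hm : 0 < m)
    (hmn : m < n) (t : F → F) {φ : F[X] → R} {ζ : R} (hζ : ζ ≠ 1)
    (hφ : ∀ f ∈ monicsOfDegree F n, φ (f + C (t (f.coeff 0)) * X ^ m) = ζ * φ f) :
    monicSum φ n = 0 := by
  have hsum := sum_monicsOfDegree_add_C_mul_X_pow hm hmn t φ
  rw [Finset.sum_congr rfl hφ, ← Finset.mul_sum] at hsum
  exact (mul_left_eq_self₀.1 hsum).resolve_left hζ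

theorem kloostermanChar_add_C_mul_X_pow [Finite F] {m n : ℕ} (hm : 0 < m) (hmn : m < n) (b : F)
    {f : F[X]} (hf : f ∈ monicsOfDegree F n) :
    kloostermanChar ψ u v (f + C b * X ^ m) =
      ψ (u * (if n - 1 = m then b else 0) + v * ((if 1 = m then b else 0) / f.coeff 0)) *
        kloostermanChar ψ u v f := by
  have h0 : (f + C b * X ^ m).coeff 0 = f.coeff 0 := by
    rw [coeff_add, coeff_C_mul_X_pow, if_neg hm.ne, add_zero]
  rw [kloostermanChar, kloostermanChar, h0, nextCoeff_add_C_mul_X_pow hmn _ hf, coeff_add,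
    coeff_C_mul_X_pow]
  by_cases hf0 : f.coeff 0 = 0
  · rw [if_pos hf0, if_pos hf0, mul_zero]
  · rw [if_neg hf0, if_neg hf0, ← AddChar.map_add_eq_mul]
    congr 1
    ring

variable {ψ u v}

theorem monicSum_kloostermanChar_of_left_ne_zero [Finite F] [IsDomain R] (hψ : ψ.IsPrimitive)
    (hu : u ≠ 0) {n : ℕ} (hn : 2 ≤ n) (hv : v = 0 ∨ 3 ≤ n) :
    monicSum (kloostermanChar ψ u v) n = 0 := by
  obtain ⟨c, hc⟩ := AddChar.ne_one_iff.1 (hψ hu)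
  refine monicSum_eq_zero_of_translate (m := n - 1) (by omega) (by omega) (fun _ => c) hc
    fun f hf => ?_
  rw [kloostermanChar_add_C_mul_X_pow ψ u v (by omega) (by omega) c hf, if_pos rfl,
    AddChar.mulShift_apply]
  rcases hv with rfl | hn3
  · rw [zero_mul, add_zero]
  · rw [if_neg (by omega), zero_div, mul_zero, add_zero]

theorem monicSum_kloostermanChar_of_right_ne_zero [Finite F] [IsDomain R] (hψ : ψ.IsPrimitive)
    (hv : v ≠ 0) {n : ℕ} (hn : 2 ≤ n) (hu : u = 0 ∨ 3 ≤ n) :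
    monicSum (kloostermanChar ψ u v) n = 0 := by
  obtain ⟨c, hc⟩ := AddChar.ne_one_iff.1 (hψ hv)
  refine monicSum_eq_zero_of_translate (m := 1) one_pos (by omega) (c * ·) hc fun f hf => ?_
  by_cases hf0 : f.coeff 0 = 0
  · rw [kloostermanChar, kloostermanChar, if_pos hf0, if_pos (by simp [hf0]), mul_zero]
  rw [kloostermanChar_add_C_mul_X_pow ψ u v one_pos (by omega) _ hf, if_pos rfl,
    AddChar.mulShift_apply, mul_div_cancel_right₀ c hf0]
  rcases hu with rfl | hn3
  · rw [zero_mul, zero_add]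
  · rw [if_neg (by omega), mul_zero, zero_add]

theorem monicSum_kloostermanChar_zero_zero [Fintype F] (n : ℕ) :
    monicSum (kloostermanChar ψ 0 0) (n + 1) = (Fintype.card F - 1) * Fintype.card F ^ n := by
  classical
  have hval : ∀ (b : F) (g : F[X]),
      kloostermanChar ψ 0 0 (X * g + C b) = if b = 0 then 0 else 1 := fun b g => by
    simp [kloostermanChar]
  rw [monicSum, sum_monicsOfDegree_succ]
  simp [hval, card_monicsOfDegree, Finset.sum_ite, Finset.filter_ne', Finset.card_erase_of_mem,
    Nat.cast_pred Fintype.card_pos]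

theorem monicSum_kloostermanChar_one [Fintype F] [DecidableEq F] :
    monicSum (kloostermanChar ψ u v) 1 = ∑ c ∈ Finset.univ.erase 0, ψ (u * c + v / c) := by
  rw [monicSum, sum_monicsOfDegree_succ, ← Finset.sum_erase _ (a := 0) (by simp [kloostermanChar])]
  refine Finset.sum_congr rfl fun c hc => ?_
  rw [monicsOfDegree_zero, Finset.sum_singleton, mul_one, kloostermanChar, nextCoeff_X_add_C]
  simp [Finset.ne_of_mem_erase hc, div_eq_mul_inv]

theorem monicSum_kloostermanChar_one_right_zero [Finite F] [IsDomain R] (hψ : ψ.IsPrimitive)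
    (hu : u ≠ 0) : monicSum (kloostermanChar ψ u 0) 1 = -1 := by
  cases nonempty_fintype F
  classical
  have hsum := AddChar.sum_mulShift u hψ
  simp only [if_neg hu, mul_comm _ u, Nat.cast_zero] at hsum
  simp only [monicSum_kloostermanChar_one, zero_div, add_zero]
  rw [Finset.sum_erase_eq_sub (Finset.mem_univ _), hsum, mul_zero, AddChar.map_zero_eq_one,
    zero_sub]

theorem monicSum_kloostermanChar_one_left_zero [Finite F] [IsDomain R] (hψ : ψ.IsPrimitive)
    (hv : v ≠ 0) : monicSum (kloostermanChar ψ 0 v) 1 = -1 := by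
  cases nonempty_fintype F
  classical
  have hsum := AddChar.sum_mulShift v hψ
  rw [if_neg hv, Nat.cast_zero, ← Equiv.sum_comp (Equiv.inv F)] at hsum
  simp only [Equiv.inv_apply, inv_mul_eq_div] at hsum
  simp only [monicSum_kloostermanChar_one, zero_mul, zero_add]
  rw [Finset.sum_erase_eq_sub (Finset.mem_univ _), hsum, div_zero, AddChar.map_zero_eq_one,
    zero_sub]

theorem monicSum_kloostermanChar_two [Fintype F] [IsDomain R] (hψ : ψ.IsPrimitive)
    (hu : u ≠ 0) (hv : v ≠ 0) : monicSum (kloostermanChar ψ u v) 2 = Fintype.card F := by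
  classical
  have hval : ∀ c b : F, kloostermanChar ψ u v (X * (X + C b) + C c) =
      if c = 0 then 0 else ψ (b * (u + v / c)) := fun c b => by
    rw [kloostermanChar_X_mul_add_C ψ u v (by simp), nextCoeff_X_add_C, coeff_add, coeff_X_zero,
      coeff_C_zero, zero_add]
    ring_nf
  have hsum : monicSum (kloostermanChar ψ u v) 2 =
      ∑ c : F, ∑ b : F, if c = 0 then 0 else ψ (b * (u + v / c)) := by
    simp only [monicSum, sum_monicsOfDegree_succ, monicsOfDegree_zero, Finset.sum_singleton,
      mul_one, hval]
  have hroot : ∀ c : F, c ≠ 0 → (u + v / c = 0 ↔ c = -v / u) := fun c hc => by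
    field_simp
    constructor <;> intro h <;> linear_combination h
  rw [hsum, Finset.sum_eq_single (-v / u)]
  · have hc : -v / u ≠ 0 := div_ne_zero (neg_ne_zero.2 hv) hu
    simp only [if_neg hc, (hroot _ hc).2 rfl, mul_zero, AddChar.map_zero_eq_one]
    simp
  · intro c _ hne
    by_cases hc : c = 0
    · simp [hc]
    · simp only [if_neg hc]
      rw [AddChar.sum_mulShift _ hψ, if_neg (mt (hroot c hc).1 hne), Nat.cast_zero]
  · exact fun h => absurd (Finset.mem_univ _) h

theorem monicSeries_kloostermanChar_zero_zero [Fintype F] :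
    monicSeries (kloostermanChar ψ 0 0) *
        (1 - PowerSeries.C (Fintype.card F : R) * PowerSeries.X) =
      1 - PowerSeries.C 1 * PowerSeries.X := by
  have h0 := (isMonicCharacter_kloostermanChar ψ 0 0).monicSum_zero
  ext n
  rw [mul_sub, mul_one, mul_left_comm, map_sub, PowerSeries.coeff_C_mul, map_one, one_mul, map_sub]
  match n with
  | 0 => simp [monicSeries, h0]
  | 1 =>
    simp [monicSeries, h0, PowerSeries.coeff_succ_mul_X, monicSum_kloostermanChar_zero_zero]
  | n + 2 =>
    simp only [monicSeries, PowerSeries.coeff_succ_mul_X, PowerSeries.coeff_mk,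
      monicSum_kloostermanChar_zero_zero, PowerSeries.coeff_one, PowerSeries.coeff_X]
    rw [if_neg (by omega), if_neg (by omega)]
    ring

theorem primePowerSum_kloostermanChar_zero_zero [Fintype F] [IsDomain R] {k : ℕ} (hk : k ≠ 0) :
    primePowerSum (kloostermanChar ψ 0 0) k = Fintype.card F ^ k - 1 := by
  rw [(isMonicCharacter_kloostermanChar ψ 0 0).primePowerSum_of_mul_eq
    monicSeries_kloostermanChar_zero_zero hk, one_pow]

theorem primePowerSum_kloostermanChar_right_zero [Finite F] [IsDomain R] (hψ : ψ.IsPrimitive)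
    (hu : u ≠ 0) {k : ℕ} (hk : k ≠ 0) : primePowerSum (kloostermanChar ψ u 0) k = -1 :=
  (isMonicCharacter_kloostermanChar ψ u 0).primePowerSum_eq_neg_one
    (monicSum_kloostermanChar_one_right_zero hψ hu)
    (fun _ hn => monicSum_kloostermanChar_of_left_ne_zero hψ hu hn (Or.inl rfl)) hk

theorem primePowerSum_kloostermanChar_left_zero [Finite F] [IsDomain R] (hψ : ψ.IsPrimitive)
    (hv : v ≠ 0) {k : ℕ} (hk : k ≠ 0) : primePowerSum (kloostermanChar ψ 0 v) k = -1 :=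
  (isMonicCharacter_kloostermanChar ψ 0 v).primePowerSum_eq_neg_one
    (monicSum_kloostermanChar_one_left_zero hψ hv)
    (fun _ hn => monicSum_kloostermanChar_of_right_ne_zero hψ hv hn (Or.inl rfl)) hk

-- The L-series is `1 + K T + q T ^ 2 = (1 - α T) (1 - β T)`, with `K` the Kloosterman sum.
theorem primePowerSum_kloostermanChar [Fintype F] [IsDomain R] [DecidableEq F] (hψ : ψ.IsPrimitive)
    (hu : u ≠ 0) (hv : v ≠ 0) {α β : R}
    (hadd : α + β = -∑ c ∈ Finset.univ.erase 0, ψ (u * c + v / c))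
    (hmul : α * β = Fintype.card F) {k : ℕ} (hk : k ≠ 0) :
    primePowerSum (kloostermanChar ψ u v) k = -(α ^ k + β ^ k) := by
  have hχ := isMonicCharacter_kloostermanChar ψ u v
  refine hχ.primePowerSum_of_eq_mul ?_ hk
  rw [← monicSum_kloostermanChar_one] at hadd
  rw [← monicSum_kloostermanChar_two hψ hu hv] at hmul
  rw [hχ.monicSeries_eq_of_three_le fun n hn =>
    monicSum_kloostermanChar_of_left_ne_zero hψ hu (by omega) (Or.inr hn), ← hmul,
    ← neg_neg (monicSum _ 1), ← hadd]
  simp only [map_neg, map_add, map_mul]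
  ring

end Kloosterman

section Orthogonality

variable {F R : Type*} [Field F] [Fintype F] [DecidableEq F] [CommRing R] [IsDomain R]
  {ψ : AddChar F R}

theorem sum_sum_addChar_mul_kloostermanChar_pow (hψ : ψ.IsPrimitive) (a : F) {b : F} (hb : b ≠ 0)
    {m : ℕ} (hm : m ≠ 0) (P : F[X]) :
    ∑ u, ∑ v, ψ (-(u * a + v * b)) * kloostermanChar ψ u v P ^ m =
      if m * P.nextCoeff = a ∧ m * (P.coeff 1 / P.coeff 0) = b then (Fintype.card F : R) ^ 2
      else 0 := by
  by_cases hP : P.coeff 0 = 0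
  · simp [kloostermanChar, hP, hm, hb.symm]
  have hterm : ∀ u v, ψ (-(u * a + v * b)) * kloostermanChar ψ u v P ^ m =
      ψ (u * (m * P.nextCoeff - a)) * ψ (v * (m * (P.coeff 1 / P.coeff 0) - b)) := fun u v => by
    rw [kloostermanChar, if_neg hP, ← AddChar.map_nsmul_eq_pow, ← AddChar.map_add_eq_mul,
      ← AddChar.map_add_eq_mul, nsmul_eq_mul]
    ring_nf
  simp only [hterm, ← Finset.sum_mul_sum, AddChar.sum_mulShift _ hψ, sub_eq_zero]
  split_ifs <;> simp_all [sq]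

theorem sum_sum_addChar_mul_primePowerSum_kloostermanChar (hψ : ψ.IsPrimitive) (a : F) {b : F}
    (hb : b ≠ 0) (k : ℕ) :
    ∑ u, ∑ v, ψ (-(u * a + v * b)) * primePowerSum (kloostermanChar ψ u v) k =
      Fintype.card F ^ 2 * ∑ d ∈ k.divisors, (d : R) *
        #{P ∈ irreduciblesOfDegree F d | (k / d : ℕ) * P.nextCoeff = a ∧
          (k / d : ℕ) * (P.coeff 1 / P.coeff 0) = b} := by
  simp only [primePowerSum, Finset.mul_sum]
  rw [Finset.sum_congr rfl fun u _ => Finset.sum_comm, Finset.sum_comm]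
  refine Finset.sum_congr rfl fun d hd => ?_
  have hm : k / d ≠ 0 :=
    (Nat.div_pos (Nat.divisor_le hd) (Nat.pos_of_mem_divisors hd)).ne'
  rw [Finset.sum_congr rfl fun u _ => Finset.sum_comm, Finset.sum_comm]
  simp only [mul_left_comm _ (d : R), ← Finset.mul_sum]
  rw [Finset.sum_congr rfl fun P _ => sum_sum_addChar_mul_kloostermanChar_pow hψ a hb hm P,
    ← Finset.sum_filter, Finset.sum_const, nsmul_eq_mul, mul_comm (#_ : R)]

end Orthogonality

/-! ### The binary Kloosterman sum -/

open Classical in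
/-- The monic irreducible polynomials `P` of degree `n` over `F` whose roots have sum `-a`, and
whose roots' inverses have sum `-b`. As division by `0` gives `0`, `X` does not occur if `b ≠ 0`. -/
noncomputable def irreduciblesWithEnds {F : Type*} [Field F] [Finite F] (n : ℕ) (a b : F) :
    Finset F[X] :=
  {P ∈ irreduciblesOfDegree F n | P.nextCoeff = a ∧ P.coeff 1 / P.coeff 0 = b}

theorem addChar_zmod_two_one {R : Type*} [CommRing R] [IsDomain R] {ψ : AddChar (ZMod 2) R}
    (hψ : ψ.IsPrimitive) : ψ 1 = -1 := by
  have hsum : ψ 0 + ψ 1 = 0 := by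
    rw [← AddChar.sum_eq_zero_of_ne_one (ψ := ψ) (by simpa using hψ one_ne_zero)]
    exact (Fin.sum_univ_two ψ).symm
  rwa [AddChar.map_zero_eq_one, add_comm, add_eq_zero_iff_eq_neg] at hsum

theorem filter_irreduciblesOfDegree_zmod_two (a : ZMod 2) (d m : ℕ) :
    {P ∈ irreduciblesOfDegree (ZMod 2) d |
        (m : ZMod 2) * P.nextCoeff = a ∧ (m : ZMod 2) * (P.coeff 1 / P.coeff 0) = 1} =
      if ¬ 2 ∣ m then irreduciblesWithEnds d a 1 else ∅ := by
  by_cases hm : 2 ∣ m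
  · simp [(ZMod.natCast_eq_zero_iff m 2).2 hm, hm]
  · have hodd : (m : ZMod 2) = 1 :=
      ZMod.natCast_eq_one_iff_odd.2 (Nat.not_even_iff_odd.1 fun h => hm h.two_dvd)
    ext P
    simp [hodd, hm, irreduciblesWithEnds]

theorem four_mul_sum_mul_card_irreduciblesWithEnds {R : Type*} [CommRing R] [IsDomain R]
    {ψ : AddChar (ZMod 2) R} (hψ : ψ.IsPrimitive) (a : ZMod 2) {k : ℕ} (hk : k ≠ 0) :
    4 * ∑ d ∈ k.divisors with ¬ 2 ∣ k / d, (d : R) * #(irreduciblesWithEnds d a 1) =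
      2 ^ k - ψ a * (1 + primePowerSum (kloostermanChar ψ 1 1) k) := by
  have horth := sum_sum_addChar_mul_primePowerSum_kloostermanChar hψ a one_ne_zero k
  simp only [filter_irreduciblesOfDegree_zmod_two, apply_ite, Finset.card_empty, Nat.cast_zero,
    mul_zero, ← Finset.sum_filter, ZMod.card] at horth
  have hsum : ∀ φ : ZMod 2 → R, ∑ u, φ u = φ 0 + φ 1 := Fin.sum_univ_two
  simp only [hsum, primePowerSum_kloostermanChar_zero_zero hk,
    primePowerSum_kloostermanChar_right_zero hψ one_ne_zero hk,
    primePowerSum_kloostermanChar_left_zero hψ one_ne_zero hk, ZMod.card, CharTwo.neg_eq,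
    AddChar.map_add_eq_mul, zero_mul, one_mul, AddChar.map_zero_eq_one,
    addChar_zmod_two_one hψ] at horth
  linear_combination -horth

theorem add_pow_eq_two_mul_pow_mul_cos (r θ : ℝ) (k : ℕ) :
    (r * Complex.exp (θ * Complex.I)) ^ k + (r * Complex.exp (-θ * Complex.I)) ^ k =
      2 * r ^ k * Complex.cos (k * θ) := by
  rw [mul_pow, mul_pow, ← Complex.exp_nat_mul, ← Complex.exp_nat_mul, ← mul_add, mul_comm 2,
    mul_assoc, Complex.two_cos, neg_mul, mul_neg, mul_assoc, neg_mul, mul_assoc]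

theorem primePowerSum_kloostermanChar_zmod_two {ψ : AddChar (ZMod 2) ℂ} (hψ : ψ.IsPrimitive)
    {θ : ℝ} (hθ : Real.cos θ = 1 / (2 * √2)) {k : ℕ} (hk : k ≠ 0) :
    primePowerSum (kloostermanChar ψ 1 1) k =
      -(2 * (-√2 : ℝ) ^ k * Complex.cos (k * θ)) := by
  set r : ℝ := -√2
  have hr : r * r = 2 := by rw [neg_mul_neg, Real.mul_self_sqrt zero_le_two]
  have hK : ∑ c ∈ Finset.univ.erase 0, ψ (1 * c + 1 / c) = 1 := by
    rw [show (Finset.univ.erase 0 : Finset (ZMod 2)) = {1} by decide, Finset.sum_singleton,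
      one_mul, div_one, CharTwo.add_self_eq_zero, AddChar.map_zero_eq_one]
  rw [← add_pow_eq_two_mul_pow_mul_cos]
  refine primePowerSum_kloostermanChar hψ one_ne_zero one_ne_zero ?_ ?_ hk
  · have hadd := add_pow_eq_two_mul_pow_mul_cos r θ 1
    have hcos : 2 * r * Real.cos θ = -1 := by
      rw [hθ]
      field_simp
      rfl
    simp only [pow_one, Nat.cast_one, one_mul] at hadd
    rw [hadd, hK]
    exact_mod_cast hcos
  · rw [mul_mul_mul_comm, ← Complex.exp_add, neg_mul, add_neg_cancel, Complex.exp_zero, mul_one,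
      ZMod.card]
    exact_mod_cast hr

theorem sum_mul_card_irreduciblesWithEnds {θ : ℝ} (hθ : Real.cos θ = 1 / (2 * √2)) (a : ZMod 2)
    {k : ℕ} (hk : k ≠ 0) :
    4 * ∑ d ∈ k.divisors with ¬ 2 ∣ k / d, (d : ℝ) * #(irreduciblesWithEnds d a 1) =
      2 ^ k - (-1) ^ a.val * (1 - 2 * (-√2) ^ k * Real.cos (k * θ)) := by
  have hζ : IsPrimitiveRoot (-1 : ℂ) 2 := IsPrimitiveRoot.neg_one 0 (by norm_num)
  have hψ := AddChar.zmodChar_primitive_of_primitive_root 2 hζ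
  have hcount := four_mul_sum_mul_card_irreduciblesWithEnds hψ a hk
  rw [primePowerSum_kloostermanChar_zmod_two hψ hθ hk, AddChar.zmodChar_apply, ← sub_eq_add_neg]
    at hcount
  exact_mod_cast hcount

/-! ### Twisted Möbius inversion -/

open ArithmeticFunction in
theorem pmul_mul_pmul_of_map_mul {R : Type*} [CommSemiring R] {c : ArithmeticFunction R}
    (hc : ∀ m n, c (m * n) = c m * c n) (f g : ArithmeticFunction R) :
    c.pmul f * c.pmul g = c.pmul (f * g) := by
  ext n
  rw [mul_apply, pmul_apply, mul_apply, Finset.mul_sum]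
  refine Finset.sum_congr rfl fun x hx => ?_
  rw [pmul_apply, pmul_apply, ← (Nat.mem_divisorsAntidiagonal.1 hx).1, hc, mul_mul_mul_comm]

theorem eq_sum_moebius_mul_of_sum_mul_eq {R : Type*} [CommRing R] {c : ArithmeticFunction R}
    (hc₁ : c 1 = 1) (hc : ∀ m n, c (m * n) = c m * c n) {f g : ℕ → R}
    (h : ∀ k ≠ 0, ∑ d ∈ k.divisors, c (k / d) * f d = g k) {n : ℕ} (hn : n ≠ 0) :
    f n = ∑ j ∈ n.divisors, c j * ArithmeticFunction.moebius j * g (n / j) := by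
  let F : ArithmeticFunction R := ⟨fun k => if k = 0 then 0 else f k, if_pos rfl⟩
  let G : ArithmeticFunction R := ⟨fun k => if k = 0 then 0 else g k, if_pos rfl⟩
  have hinv : c.pmul (ArithmeticFunction.moebius : ArithmeticFunction R) * c = 1 := by
    calc c.pmul (ArithmeticFunction.moebius : ArithmeticFunction R) * c
        = c.pmul (ArithmeticFunction.moebius * ArithmeticFunction.zeta) := by
          rw [← pmul_mul_pmul_of_map_mul hc, c.pmul_zeta]
      _ = 1 := by
          ext k
          by_cases hk : k = 1 <;> simp [hk, hc₁]
  have hcF : c * F = G := by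
    ext k
    by_cases hk : k = 0
    · simp [hk]
    rw [ArithmeticFunction.mul_apply,
      Nat.sum_divisorsAntidiagonal' (f := fun i j => c i * F j)]
    refine (Finset.sum_congr rfl fun d hd => ?_).trans ((h k hk).trans (if_neg hk).symm)
    rw [show F d = f d from if_neg (Nat.pos_of_mem_divisors hd).ne']
  have hF : F = c.pmul (ArithmeticFunction.moebius : ArithmeticFunction R) * G := by
    rw [← hcF, ← mul_assoc, hinv, one_mul]
  calc f n = F n := (if_neg hn).symm
    _ = ∑ j ∈ n.divisors, c j * ArithmeticFunction.moebius j * G (n / j) := by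
      rw [hF, ArithmeticFunction.mul_apply,
        Nat.sum_divisorsAntidiagonal (f := fun i j =>
          c.pmul (ArithmeticFunction.moebius : ArithmeticFunction R) i * G j)]
      simp only [ArithmeticFunction.pmul_apply, ArithmeticFunction.intCoe_apply]
    _ = ∑ j ∈ n.divisors, c j * ArithmeticFunction.moebius j * g (n / j) :=
      Finset.sum_congr rfl fun j hj => by
        rw [show G (n / j) = g (n / j) from
          if_neg (Nat.div_pos (Nat.divisor_le hj) (Nat.pos_of_mem_divisors hj)).ne']

theorem eq_sum_moebius_mul_of_sum_not_dvd_eq {R : Type*} [CommRing R] {p : ℕ} (hp : p.Prime)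
    {f g : ℕ → R} (h : ∀ k ≠ 0, ∑ d ∈ k.divisors with ¬ p ∣ k / d, f d = g k) {n : ℕ}
    (hn : n ≠ 0) :
    f n = ∑ j ∈ n.divisors with ¬ p ∣ j, (ArithmeticFunction.moebius j : R) * g (n / j) := by
  let c : ArithmeticFunction R := ⟨fun k => if ¬ p ∣ k then 1 else 0, by simp⟩
  have hc : ∀ k, c k = if ¬ p ∣ k then 1 else 0 := fun _ => rfl
  have hmul : ∀ k l, c (k * l) = c k * c l := fun k l => by
    by_cases hk : p ∣ k <;> by_cases hl : p ∣ l <;> simp [hc, hp.dvd_mul, hk, hl]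
  have hinv := eq_sum_moebius_mul_of_sum_mul_eq (c := c) (f := f) (g := g)
    (by simp [hc, hp.ne_one]) hmul
  simp only [hc, ite_mul, one_mul, zero_mul, ← Finset.sum_filter] at hinv
  exact hinv h hn

/-! ### The lift of a polynomial along `x ↦ x + 1 / x` -/

section ReciprocalLift

variable {R : Type*} [CommRing R]

/-- The polynomial `x ^ n * g (x + 1 / x)`, for `g` of degree at most `n`; the coefficients of `g`
beyond degree `n` are ignored. Every self-reciprocal polynomial of even degree arises this way. -/
noncomputable def reciprocalLift (n : ℕ) (g : R[X]) : R[X] :=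
  ∑ i ∈ Finset.range (n + 1), C (g.coeff i) * X ^ (n - i) * (X ^ 2 + 1) ^ i

theorem reciprocalLift_zero (g : R[X]) : reciprocalLift 0 g = C (g.coeff 0) := by
  simp [reciprocalLift]

theorem reciprocalLift_succ (n : ℕ) (g : R[X]) :
    reciprocalLift (n + 1) g =
      X * reciprocalLift n g + C (g.coeff (n + 1)) * (X ^ 2 + 1) ^ (n + 1) := by
  rw [reciprocalLift, Finset.sum_range_succ, Nat.sub_self, pow_zero, mul_one, reciprocalLift,
    Finset.mul_sum]
  congr 1
  refine Finset.sum_congr rfl fun i hi => ?_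
  rw [Nat.sub_add_comm (Nat.lt_succ_iff.1 (Finset.mem_range.1 hi)), pow_succ]
  ring

theorem reciprocalLift_congr {n : ℕ} {g h : R[X]} (hgh : ∀ i ≤ n, g.coeff i = h.coeff i) :
    reciprocalLift n g = reciprocalLift n h :=
  Finset.sum_congr rfl fun i hi => by rw [hgh i (Nat.lt_succ_iff.1 (Finset.mem_range.1 hi))]

theorem aeval_reciprocalLift {A : Type*} [CommRing A] [Algebra R A] {β γ : A} (hβγ : β * γ = 1)
    {n : ℕ} {g : R[X]} (hg : g.natDegree ≤ n) :
    aeval β (reciprocalLift n g) = β ^ n * aeval (β + γ) g := by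
  have hadd : β * (β + γ) = β ^ 2 + 1 := by rw [mul_add, hβγ, sq]
  rw [aeval_eq_sum_range' (Nat.lt_succ_iff.2 hg), reciprocalLift, map_sum, Finset.mul_sum]
  refine Finset.sum_congr rfl fun i hi => ?_
  obtain ⟨j, rfl⟩ := Nat.exists_eq_add_of_le (Nat.lt_succ_iff.1 (Finset.mem_range.1 hi))
  simp only [map_mul, map_pow, map_add, aeval_X, aeval_C, map_one]
  rw [← hadd, Algebra.smul_def, Nat.add_sub_cancel_left, mul_pow]
  ring

theorem reciprocalLift_mul {m n : ℕ} {g h : R[X]} (hg : g.natDegree ≤ m) (hh : h.natDegree ≤ n) :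
    reciprocalLift (m + n) (g * h) = reciprocalLift m g * reciprocalLift n h := by
  have hT : LaurentPolynomial.T 1 * LaurentPolynomial.T (-1) = (1 : LaurentPolynomial R) := by
    rw [← LaurentPolynomial.T_add, add_neg_cancel, LaurentPolynomial.T_zero]
  have htoLaurent : toLaurentAlg = aeval (R := R) (LaurentPolynomial.T 1) :=
    algHom_ext (by rw [toLaurentAlg_apply, toLaurent_X, aeval_X])
  apply toLaurent_injective
  rw [map_mul]
  simp only [← toLaurentAlg_apply, htoLaurent]
  rw [aeval_reciprocalLift hT hg, aeval_reciprocalLift hT hh,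
    aeval_reciprocalLift hT (natDegree_mul_le.trans (add_le_add hg hh)), map_mul, pow_add]
  ring

theorem X_sq_add_one_pow_eq_expand (m : ℕ) :
    (X ^ 2 + 1 : R[X]) ^ m = expand R 2 ((X + 1) ^ m) := by
  rw [map_pow, map_add, expand_X, map_one]

theorem natDegree_X_sq_add_one_le : (X ^ 2 + 1 : R[X]).natDegree ≤ 2 := by
  compute_degree

theorem natDegree_X_sq_add_one_pow_le (m : ℕ) : ((X ^ 2 + 1 : R[X]) ^ m).natDegree ≤ 2 * m := by
  rw [mul_comm]
  exact natDegree_pow_le_of_le m natDegree_X_sq_add_one_le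

theorem coeff_two_mul_X_sq_add_one_pow (m : ℕ) : ((X ^ 2 + 1 : R[X]) ^ m).coeff (2 * m) = 1 := by
  rw [X_sq_add_one_pow_eq_expand, coeff_expand_mul' two_pos, coeff_X_add_one_pow, Nat.choose_self,
    Nat.cast_one]

theorem coeff_two_mul_add_one_X_sq_add_one_pow (m k : ℕ) :
    ((X ^ 2 + 1 : R[X]) ^ m).coeff (2 * k + 1) = 0 := by
  rw [X_sq_add_one_pow_eq_expand, coeff_expand two_pos, if_neg (by omega)]

theorem reflect_X_sq_add_one_pow (m : ℕ) :
    reflect (2 * m) ((X ^ 2 + 1 : R[X]) ^ m) = (X ^ 2 + 1) ^ m := by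
  induction m with
  | zero => simp
  | succ m ih =>
    have hbase : reflect 2 (X ^ 2 + 1 : R[X]) = X ^ 2 + 1 := by
      rw [reflect_add, reflect_monomial, reflect_one, revAt_le le_rfl, Nat.sub_self, pow_zero,
        add_comm]
    rw [pow_succ, Nat.mul_succ, reflect_mul _ _ (natDegree_X_sq_add_one_pow_le m)
      natDegree_X_sq_add_one_le, ih, hbase]

theorem reflect_X_mul {q : R[X]} {n : ℕ} (hq : q.natDegree ≤ 2 * n) :
    reflect (2 * (n + 1)) (X * q) = X * reflect (2 * n) q := by
  have hX : reflect 2 (X : R[X]) = X := by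
    simpa only [pow_one, revAt_le one_le_two, Nat.reduceSub] using reflect_monomial (R := R) 2 1
  rw [mul_add_one, add_comm, reflect_mul _ _ (natDegree_X_le.trans one_le_two) hq, hX]

theorem natDegree_reciprocalLift_le (n : ℕ) (g : R[X]) :
    (reciprocalLift n g).natDegree ≤ 2 * n := by
  induction n with
  | zero => simp [reciprocalLift_zero]
  | succ n ih =>
    rw [reciprocalLift_succ]
    refine natDegree_add_le_of_degree_le (natDegree_mul_le.trans ?_)
      ((natDegree_C_mul_le _ _).trans (natDegree_X_sq_add_one_pow_le _))
    have := natDegree_X_le (R := R)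
    omega

theorem coeff_two_mul_reciprocalLift (n : ℕ) (g : R[X]) :
    (reciprocalLift n g).coeff (2 * n) = g.coeff n := by
  cases n with
  | zero => simp [reciprocalLift_zero]
  | succ n =>
    rw [reciprocalLift_succ, coeff_add, coeff_C_mul, coeff_two_mul_X_sq_add_one_pow, mul_one,
      show 2 * (n + 1) = 2 * n + 1 + 1 by ring, coeff_X_mul, coeff_eq_zero_of_natDegree_lt,
      zero_add]
    exact Nat.lt_succ_of_le (natDegree_reciprocalLift_le n g)

theorem coeff_two_mul_add_one_reciprocalLift (n : ℕ) (g : R[X]) :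
    (reciprocalLift (n + 1) g).coeff (2 * n + 1) = g.coeff n := by
  rw [reciprocalLift_succ, coeff_add, coeff_C_mul, coeff_two_mul_add_one_X_sq_add_one_pow, mul_zero,
    add_zero, coeff_X_mul, coeff_two_mul_reciprocalLift]

theorem reflect_reciprocalLift (n : ℕ) (g : R[X]) :
    reflect (2 * n) (reciprocalLift n g) = reciprocalLift n g := by
  induction n with
  | zero => simp [reciprocalLift_zero]
  | succ n ih =>
    rw [reciprocalLift_succ, reflect_add, reflect_C_mul, reflect_X_sq_add_one_pow,
      reflect_X_mul (natDegree_reciprocalLift_le n g), ih]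

theorem coeff_eq_of_reciprocalLift_eq {n : ℕ} {g h : R[X]}
    (hgh : reciprocalLift n g = reciprocalLift n h) : ∀ i ≤ n, g.coeff i = h.coeff i := by
  induction n with
  | zero =>
    intro i hi
    rw [Nat.le_zero.1 hi]
    simpa [reciprocalLift_zero] using hgh
  | succ n ih =>
    have htop : g.coeff (n + 1) = h.coeff (n + 1) := by
      rw [← coeff_two_mul_reciprocalLift, hgh, coeff_two_mul_reciprocalLift]
    rw [reciprocalLift_succ, reciprocalLift_succ, htop, add_left_inj] at hgh
    intro i hi
    rcases Nat.le_or_eq_of_le_succ hi with hi | rfl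
    · exact ih (isRegular_X.left hgh) i hi
    · exact htop

theorem exists_X_mul_eq_of_reflect_eq {n : ℕ} {q : R[X]} (hq : q.natDegree ≤ 2 * (n + 1))
    (hr : reflect (2 * (n + 1)) q = q) (htop : q.coeff (2 * (n + 1)) = 0) :
    ∃ r : R[X], r.natDegree ≤ 2 * n ∧ reflect (2 * n) r = r ∧ X * r = q := by
  have hconst : q.coeff 0 = 0 := by rw [← hr, coeff_reflect, revAt_zero, htop]
  have hX : X * q.divX = q := by
    simpa only [hconst, C_0, add_zero] using X_mul_divX_add q
  have hlt : q.natDegree ≠ 2 * (n + 1) := fun h => by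
    have hq0 : q = 0 := leadingCoeff_eq_zero.1 (by rw [leadingCoeff, h, htop])
    rw [hq0, natDegree_zero] at h
    omega
  have hdeg : q.divX.natDegree ≤ 2 * n := by
    rw [natDegree_divX_eq_natDegree_tsub_one]
    omega
  refine ⟨q.divX, hdeg, isRegular_X.left ?_, hX⟩
  change X * reflect (2 * n) q.divX = X * q.divX
  rw [← reflect_X_mul hdeg, hX, hr]

theorem exists_reciprocalLift_eq {n : ℕ} {f : R[X]} (hf : f.natDegree ≤ 2 * n)
    (hr : reflect (2 * n) f = f) : ∃ g : R[X], g.natDegree ≤ n ∧ reciprocalLift n g = f := by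
  induction n generalizing f with
  | zero =>
    exact ⟨f, hf, by rw [reciprocalLift_zero, ← eq_C_of_natDegree_le_zero hf]⟩
  | succ n ih =>
    set b := f.coeff (2 * (n + 1))
    obtain ⟨r, hrdeg, hrr, hXr⟩ :=
      exists_X_mul_eq_of_reflect_eq (q := f - C b * (X ^ 2 + 1) ^ (n + 1))
        ((natDegree_sub_le _ _).trans (max_le hf ((natDegree_C_mul_le _ _).trans
          (natDegree_X_sq_add_one_pow_le _))))
        (by rw [reflect_sub, hr, reflect_C_mul, reflect_X_sq_add_one_pow])
        (by rw [coeff_sub, coeff_C_mul, coeff_two_mul_X_sq_add_one_pow, mul_one, sub_self])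
    obtain ⟨g, hg, hgr⟩ := ih hrdeg hrr
    refine ⟨g + C b * X ^ (n + 1),
      natDegree_add_le_of_degree_le (hg.trans n.le_succ) (natDegree_C_mul_X_pow_le _ _), ?_⟩
    have hlower : reciprocalLift n (g + C b * X ^ (n + 1)) = reciprocalLift n g :=
      reciprocalLift_congr fun i hi => by
        rw [coeff_add, coeff_C_mul_X_pow, if_neg (by omega), add_zero]
    rw [reciprocalLift_succ, hlower, hgr, hXr, coeff_add, coeff_C_mul_X_pow, if_pos rfl,
      coeff_eq_zero_of_natDegree_lt (Nat.lt_succ_of_le hg), zero_add, sub_add_cancel]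

theorem monic_reciprocalLift {g : R[X]} (hg : g.Monic) : (reciprocalLift g.natDegree g).Monic :=
  monic_of_natDegree_le_of_coeff_eq_one _ (natDegree_reciprocalLift_le _ g)
    (by rw [coeff_two_mul_reciprocalLift, hg.coeff_natDegree])

theorem natDegree_reciprocalLift {g : R[X]} (hg : g.Monic) :
    (reciprocalLift g.natDegree g).natDegree = 2 * g.natDegree := by
  nontriviality R
  refine le_antisymm (natDegree_reciprocalLift_le _ g) (le_natDegree_of_ne_zero ?_)
  rw [coeff_two_mul_reciprocalLift, hg.coeff_natDegree]
  exact one_ne_zero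

theorem nextCoeff_reciprocalLift {g : R[X]} (hg : g.Monic) :
    (reciprocalLift g.natDegree g).nextCoeff = g.nextCoeff := by
  have hdeg := natDegree_reciprocalLift hg
  rcases eq_or_ne g.natDegree 0 with hn | hn
  · rw [nextCoeff, nextCoeff, if_pos (by omega), if_pos hn]
  · obtain ⟨n, hn⟩ := Nat.exists_eq_succ_of_ne_zero hn
    rw [nextCoeff_of_natDegree_pos (by omega), nextCoeff_of_natDegree_pos (by omega), hdeg, hn]
    exact coeff_two_mul_add_one_reciprocalLift n g

theorem reverse_reciprocalLift {g : R[X]} (hg : g.Monic) :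
    (reciprocalLift g.natDegree g).reverse = reciprocalLift g.natDegree g := by
  rw [reverse, natDegree_reciprocalLift hg, reflect_reciprocalLift]

end ReciprocalLift

section Irreducible

variable {F : Type*} [Field F] {g : F[X]}

theorem irreducible_of_irreducible_reciprocalLift (hg : g.Monic)
    (h : Irreducible (reciprocalLift g.natDegree g)) : Irreducible g := by
  have hne : g ≠ 1 := by
    rintro rfl
    rw [natDegree_one, reciprocalLift_zero, coeff_one_zero, C_1] at h
    exact not_irreducible_one h
  have hunit : ∀ w : F[X], w.Monic → IsUnit (reciprocalLift w.natDegree w) → w = 1 := by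
    intro w hw hu
    have := natDegree_eq_zero_of_isUnit hu
    rw [natDegree_reciprocalLift hw] at this
    exact hw.natDegree_eq_zero.1 (by omega)
  refine (irreducible_of_monic hg hne).2 fun u v hu hv huv => ?_
  rw [← huv, hu.natDegree_mul hv, reciprocalLift_mul le_rfl le_rfl] at h
  exact (h.isUnit_or_isUnit rfl).imp (hunit u hu) (hunit v hv)

theorem exists_irreducible_dvd_of_not_irreducible {f : F[X]} (hf : f.Monic) (hf1 : f ≠ 1)
    (hred : ¬ Irreducible f) :
    ∃ p : F[X], Irreducible p ∧ p ∣ f ∧ p.natDegree ≤ f.natDegree / 2 := by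
  rw [hf.irreducible_iff_lt_natDegree_lt hf1] at hred
  push Not at hred
  obtain ⟨q, hqm, hqd, hqf⟩ := hred
  rw [Finset.mem_Ioc] at hqd
  obtain ⟨p, hpi, hpq⟩ := exists_irreducible_of_natDegree_pos hqd.1
  exact ⟨p, hpi, hpq.trans hqf, (natDegree_le_of_dvd hpq hqm.ne_zero).trans hqd.2⟩

theorem finrank_adjoinRoot (hg : g ≠ 0) : Module.finrank F (AdjoinRoot g) = g.natDegree := by
  rw [(AdjoinRoot.powerBasis hg).finrank, AdjoinRoot.powerBasis_dim]

theorem finiteDimensional_adjoinRoot (hg : g ≠ 0) : FiniteDimensional F (AdjoinRoot g) :=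
  (AdjoinRoot.powerBasis hg).finite

theorem exists_algEquiv_adjoinRoot [Fact (Irreducible g)] {L : Type*} [Field L] [Algebra F L]
    [FiniteDimensional F L] {γ : L} (hγ : aeval γ g = 0)
    (hL : Module.finrank F L ≤ g.natDegree) :
    ∃ e : AdjoinRoot g ≃ₐ[F] L, e (AdjoinRoot.root g) = γ := by
  have hg : g ≠ 0 := (Fact.out : Irreducible g).ne_zero
  have := finiteDimensional_adjoinRoot hg
  let φ : AdjoinRoot g →ₐ[F] L := AdjoinRoot.liftAlgHom g (Algebra.ofId F L) γ hγ
  have hfinrank : Module.finrank F (AdjoinRoot g) = Module.finrank F L :=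
    (φ.toLinearMap.finrank_le_finrank_of_injective φ.injective).antisymm
      (by rwa [finrank_adjoinRoot hg])
  have hsurj : Function.Surjective φ :=
    (LinearMap.injective_iff_surjective_of_finrank_eq_finrank (f := φ.toLinearMap) hfinrank).1
      φ.injective
  exact ⟨AlgEquiv.ofBijective φ ⟨φ.injective, hsurj⟩,
    AdjoinRoot.liftAlgHom_root g (Algebra.ofId F L) γ hγ⟩

theorem add_inv_ne_root_of_irreducible_reciprocalLift [Fact (Irreducible g)] (hg : g.Monic)
    (h : Irreducible (reciprocalLift g.natDegree g)) {β : AdjoinRoot g} (hβ : β ≠ 0) :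
    β + β⁻¹ ≠ AdjoinRoot.root g := by
  intro hroot
  have hlift : aeval β (reciprocalLift g.natDegree g) = 0 := by
    rw [aeval_reciprocalLift (mul_inv_cancel₀ hβ) le_rfl, hroot, AdjoinRoot.aeval_eq,
      AdjoinRoot.mk_self, mul_zero]
  have := finiteDimensional_adjoinRoot hg.ne_zero
  have hle := minpoly.natDegree_le (A := F) β
  rw [← minpoly.eq_of_irreducible_of_monic h hlift (monic_reciprocalLift hg),
    natDegree_reciprocalLift hg, finrank_adjoinRoot hg.ne_zero] at hle
  have hpos := (Fact.out : Irreducible g).natDegree_pos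
  omega

theorem exists_add_inv_eq_root_of_not_irreducible_reciprocalLift [Fact (Irreducible g)]
    (hg : g.Monic) (h : ¬ Irreducible (reciprocalLift g.natDegree g)) :
    ∃ β : AdjoinRoot g, β ≠ 0 ∧ β + β⁻¹ = AdjoinRoot.root g := by
  have hpos := (Fact.out : Irreducible g).natDegree_pos
  have hdeg := natDegree_reciprocalLift hg
  obtain ⟨p, hp, hpdvd, hpdeg⟩ := exists_irreducible_dvd_of_not_irreducible
    (monic_reciprocalLift hg) (fun h1 => by rw [h1, natDegree_one] at hdeg; omega) h
  have : Fact (Irreducible p) := ⟨hp⟩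
  have := finiteDimensional_adjoinRoot hp.ne_zero
  have hlift : aeval (AdjoinRoot.root p) (reciprocalLift g.natDegree g) = 0 := by
    rw [AdjoinRoot.aeval_eq, AdjoinRoot.mk_eq_zero]
    exact hpdvd
  have hne : AdjoinRoot.root p ≠ 0 := by
    intro h0
    rw [h0, ← coeff_zero_eq_aeval_zero', ← reflect_reciprocalLift, coeff_reflect, revAt_zero,
      coeff_two_mul_reciprocalLift, hg.coeff_natDegree, map_one] at hlift
    exact one_ne_zero hlift
  rw [aeval_reciprocalLift (mul_inv_cancel₀ hne) le_rfl] at hlift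
  obtain ⟨e, he⟩ := exists_algEquiv_adjoinRoot
    ((mul_eq_zero.1 hlift).resolve_left (pow_ne_zero _ hne))
    (by rw [finrank_adjoinRoot hp.ne_zero]; omega)
  refine ⟨e.symm (AdjoinRoot.root p), (map_ne_zero e.symm).2 hne, ?_⟩
  rw [← map_inv₀, ← map_add, ← he, e.symm_apply_apply]

theorem irreducible_reciprocalLift_iff [Fact (Irreducible g)] (hg : g.Monic) :
    Irreducible (reciprocalLift g.natDegree g) ↔
      ∀ β : AdjoinRoot g, β ≠ 0 → β + β⁻¹ ≠ AdjoinRoot.root g := by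
  refine ⟨fun h _ => add_inv_ne_root_of_irreducible_reciprocalLift hg h, fun h => ?_⟩
  by_contra hred
  obtain ⟨β, hβ, hroot⟩ := exists_add_inv_eq_root_of_not_irreducible_reciprocalLift hg hred
  exact h β hβ hroot

end Irreducible

/-! ### Traces and the irreducibility of the lift in characteristic two -/

section Trace

variable {K L : Type*} [Field K] [Field L] [Algebra K L]

theorem adjoin_simple_inv (α : L) :
    IntermediateField.adjoin K {α⁻¹} = IntermediateField.adjoin K {α} := by
  refine le_antisymm ?_ ?_ <;> rw [IntermediateField.adjoin_simple_le_iff]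
  · exact inv_mem (IntermediateField.mem_adjoin_simple_self K α)
  · simpa only [inv_inv] using inv_mem (IntermediateField.mem_adjoin_simple_self K α⁻¹)

theorem minpoly_inv {α : L} (hα : IsIntegral K α) (hα0 : α ≠ 0) :
    minpoly K α⁻¹ = C ((minpoly K α).coeff 0)⁻¹ * (minpoly K α).reverse := by
  have h0 : (minpoly K α).coeff 0 ≠ 0 := minpoly.coeff_zero_ne_zero hα hα0
  have hroot : aeval α⁻¹ (minpoly K α).reverse = 0 := by
    let := invertibleOfNonzero hα0
    rw [← invOf_eq_inv]
    exact (eval₂_reverse_eq_zero_iff _ _ _).2 (minpoly.aeval K α)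
  have hmonic : (C ((minpoly K α).coeff 0)⁻¹ * (minpoly K α).reverse).Monic := by
    rw [Monic, leadingCoeff_mul, leadingCoeff_C, reverse_leadingCoeff, trailingCoeff,
      natTrailingDegree_eq_zero.2 (Or.inr h0), inv_mul_cancel₀ h0]
  have hdeg : (minpoly K α⁻¹).natDegree = (minpoly K α).natDegree := by
    rw [← IntermediateField.adjoin.finrank hα, ← IntermediateField.adjoin.finrank hα.inv,
      adjoin_simple_inv]
  refine (eq_of_monic_of_dvd_of_natDegree_le (minpoly.monic hα.inv) hmonic
    (minpoly.dvd K _ (by rw [map_mul, hroot, mul_zero])) ?_).symm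
  rw [hdeg]
  exact (natDegree_C_mul_le _ _).trans (reverse_natDegree_le _)

theorem nextCoeff_minpoly_inv {α : L} (hα : IsIntegral K α) :
    (minpoly K α⁻¹).nextCoeff = (minpoly K α).coeff 1 / (minpoly K α).coeff 0 := by
  rcases eq_or_ne α 0 with rfl | hα0
  · rw [inv_zero, minpoly.zero, coeff_X_zero, div_zero, ← add_zero X, ← C_0, nextCoeff_X_add_C]
  have h0 : (minpoly K α).coeff 0 ≠ 0 := minpoly.coeff_zero_ne_zero hα hα0
  have hpos : 0 < (minpoly K α).natDegree := minpoly.natDegree_pos hα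
  have hdeg : (minpoly K α).reverse.natDegree = (minpoly K α).natDegree := by
    rw [reverse_natDegree, natTrailingDegree_eq_zero.2 (Or.inr h0), Nat.sub_zero]
  rw [minpoly_inv hα hα0, nextCoeff_C_mul, nextCoeff_of_natDegree_pos (by rwa [hdeg]), hdeg,
    coeff_reverse, revAt_le (Nat.sub_le _ _), Nat.sub_sub_self hpos, div_eq_inv_mul]

theorem trace_inv_root {g : K[X]} (hm : g.Monic) [Fact (Irreducible g)] :
    Algebra.trace K (AdjoinRoot g) (AdjoinRoot.root g)⁻¹ = -(g.coeff 1 / g.coeff 0) := by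
  have hg : g ≠ 0 := hm.ne_zero
  have := finiteDimensional_adjoinRoot hg
  have hmin : minpoly K (AdjoinRoot.root g) = g := by
    rw [AdjoinRoot.minpoly_root hg, hm.leadingCoeff, inv_one, C_1, mul_one]
  have htop : IntermediateField.adjoin K {AdjoinRoot.root g} = ⊤ :=
    (Field.primitive_element_iff_minpoly_natDegree_eq K _).2 (by rw [hmin, finrank_adjoinRoot hg])
  rw [trace_eq_finrank_mul_minpoly_nextCoeff, adjoin_simple_inv, htop,
    IntermediateField.finrank_top, Nat.cast_one, one_mul, nextCoeff_minpoly_inv (.of_finite K _),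
    hmin]

theorem pow_card_eq_self_iff [Fintype K] {u : L} :
    u ^ Fintype.card K = u ↔ u ∈ (algebraMap K L).range := by
  constructor
  · intro hu
    have hsplits := (FiniteField.isSplittingField_sub K K).splits
    rw [Algebra.algebraMap_self, Polynomial.map_id] at hsplits
    refine hsplits.mem_range_of_isRoot
      (FiniteField.X_pow_card_sub_X_ne_zero K Fintype.one_lt_card) ?_
    rw [Polynomial.map_sub, Polynomial.map_pow, map_X, IsRoot.def, eval_sub, eval_pow, eval_X, hu,
      sub_self]
  · rintro ⟨a, rfl⟩
    rw [← map_pow, FiniteField.pow_card]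

theorem trace_pow_card [Fintype K] [FiniteDimensional K L] (u : L) :
    Algebra.trace K L (u ^ Fintype.card K) = Algebra.trace K L u :=
  Algebra.trace_eq_of_algEquiv (FiniteField.frobeniusAlgEquivOfAlgebraic K L) u

theorem trace_eq_zero_iff_exists_pow_card_sub [Fintype K] [FiniteDimensional K L] {x : L} :
    Algebra.trace K L x = 0 ↔ ∃ u : L, u ^ Fintype.card K - u = x := by
  -- The image of `u ↦ u ^ q - u` lies in the kernel of the trace, and both have codimension one.
  let φ : L →ₗ[K] L := (FiniteField.frobeniusAlgHom K L).toLinearMap - LinearMap.id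
  have hφ : ∀ u, φ u = u ^ Fintype.card K - u := fun _ => rfl
  have hker : LinearMap.ker φ = Submodule.span K {1} := by
    ext u
    simp only [LinearMap.mem_ker, hφ, sub_eq_zero, pow_card_eq_self_iff, RingHom.mem_range,
      Submodule.mem_span_singleton, Algebra.algebraMap_eq_smul_one]
  have hle : LinearMap.range φ ≤ LinearMap.ker (Algebra.trace K L) := by
    rintro _ ⟨u, rfl⟩
    rw [LinearMap.mem_ker, hφ, map_sub, trace_pow_card, sub_self]
  have hφrank := LinearMap.finrank_range_add_finrank_ker φ
  have htrrank := LinearMap.finrank_range_add_finrank_ker (Algebra.trace K L)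
  rw [hker, finrank_span_singleton one_ne_zero] at hφrank
  rw [LinearMap.range_eq_top.2 (Algebra.trace_surjective K L), finrank_top,
    Module.finrank_self] at htrrank
  have hrange := Submodule.eq_of_le_of_finrank_eq hle (by omega)
  rw [← LinearMap.mem_ker, ← hrange]
  rfl

theorem exists_add_inv_eq_iff_exists_sq_sub [CharP L 2] {α : L} :
    (∃ β : L, β ≠ 0 ∧ β + β⁻¹ = α) ↔ ∃ u : L, u ^ 2 - u = α⁻¹ := by
  have h2 : (2 : L) = 0 := CharTwo.two_eq_zero
  constructor
  · rintro ⟨β, hβ, rfl⟩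
    refine ⟨(β + 1)⁻¹, ?_⟩
    rcases eq_or_ne (β + 1) 0 with h | h
    · simp [CharTwo.add_eq_zero.1 h, CharTwo.add_self_eq_zero]
    · have hsq : β + β⁻¹ = (β + 1) ^ 2 / β := by
        field_simp
        linear_combination (-β) * h2
      rw [hsq]
      field_simp
      linear_combination (-β) * h2
  · rintro ⟨u, hu⟩
    rcases eq_or_ne α 0 with rfl | hα
    · exact ⟨1, one_ne_zero, by rw [inv_one, CharTwo.add_self_eq_zero]⟩
    have hmul : u * (u - 1) ≠ 0 := by
      rw [mul_sub_one, ← sq, hu]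
      exact inv_ne_zero hα
    have hu0 : u ≠ 0 := left_ne_zero_of_mul hmul
    have hu1 : u - 1 ≠ 0 := right_ne_zero_of_mul hmul
    refine ⟨(u - 1) / u, div_ne_zero hu1 hu0, ?_⟩
    rw [← inv_inv α, ← hu, show u ^ 2 - u = u * (u - 1) by ring]
    field_simp
    linear_combination (u ^ 2 - u) * h2

end Trace

theorem irreducible_reciprocalLift_iff_trace_ne_zero {K : Type*} [Field K] [Finite K]
    [Algebra (ZMod 2) K] {g : K[X]} (hm : g.Monic) (hg : Irreducible g) :
    Irreducible (reciprocalLift g.natDegree g) ↔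
      Algebra.trace (ZMod 2) K (g.coeff 1 / g.coeff 0) ≠ 0 := by
  have : Fact (Irreducible g) := ⟨hg⟩
  have := finiteDimensional_adjoinRoot hm.ne_zero
  have : FiniteDimensional (ZMod 2) K := Module.Finite.of_finite
  have : FiniteDimensional (ZMod 2) (AdjoinRoot g) := Module.Finite.trans K _
  have : CharP (AdjoinRoot g) 2 :=
    charP_of_injective_algebraMap (algebraMap (ZMod 2) (AdjoinRoot g)).injective 2
  have htrace : Algebra.trace (ZMod 2) (AdjoinRoot g) (AdjoinRoot.root g)⁻¹ =
      -Algebra.trace (ZMod 2) K (g.coeff 1 / g.coeff 0) := by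
    rw [← Algebra.trace_trace (S := K), trace_inv_root hm, map_neg]
  rw [irreducible_reciprocalLift_iff hm, ← neg_ne_zero, ← htrace, Ne,
    trace_eq_zero_iff_exists_pow_card_sub, ZMod.card, ← exists_add_inv_eq_iff_exists_sq_sub]
  push Not
  rfl

theorem mem_selfRecipIrredLead_iff {F : Type*} [Field F] {d : ℕ} {a : F} {f : F[X]} :
    f ∈ selfRecipIrredLead F d ![a] ↔ f ∈ selfRecipIrred F d ∧ f.nextCoeff = a := by
  refine and_congr_right fun ⟨_, hirr, _, hd⟩ => ?_
  have hpos : 0 < d := hd ▸ hirr.natDegree_pos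
  rw [Fin.forall_fin_one, nextCoeff_of_natDegree_pos (hd ▸ hpos), hd, Fin.val_zero,
    zero_add, if_pos (Nat.one_le_of_lt hpos), Matrix.cons_val_zero]

theorem selfRecipIrred_eq_image {F : Type*} [Field F] (n : ℕ) :
    selfRecipIrred F (2 * n) = reciprocalLift n ''
      {g | (g.Monic ∧ g.natDegree = n) ∧ Irreducible (reciprocalLift n g)} := by
  ext f
  constructor
  · rintro ⟨hmonic, hirr, hrev, hdeg⟩
    obtain ⟨g, hg, rfl⟩ := exists_reciprocalLift_eq hdeg.le (by rwa [← hdeg])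
    have hcoeff : g.coeff n = 1 := by
      rw [← coeff_two_mul_reciprocalLift, ← hdeg]
      exact hmonic
    exact ⟨g, ⟨⟨monic_of_natDegree_le_of_coeff_eq_one n hg hcoeff,
      natDegree_eq_of_le_of_coeff_ne_zero hg (hcoeff ▸ one_ne_zero)⟩, hirr⟩, rfl⟩
  · rintro ⟨g, ⟨⟨hmonic, rfl⟩, hirr⟩, rfl⟩
    exact ⟨monic_reciprocalLift hmonic, hirr, reverse_reciprocalLift hmonic,
      natDegree_reciprocalLift hmonic⟩

theorem injOn_reciprocalLift {F : Type*} [Field F] (n : ℕ) :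
    Set.InjOn (reciprocalLift n) {g : F[X] | g.natDegree ≤ n} := by
  intro g hg h hh hgh
  ext i
  rcases le_or_gt i n with hi | hi
  · exact coeff_eq_of_reciprocalLift_eq hgh i hi
  · rw [coeff_eq_zero_of_natDegree_lt (lt_of_le_of_lt hg hi),
      coeff_eq_zero_of_natDegree_lt (lt_of_le_of_lt hh hi)]

open Classical in
theorem numSelfRecip_eq_card {K : Type*} [Field K] [Finite K] [Algebra (ZMod 2) K] (n : ℕ) (a : K) :
    numSelfRecip K n ![a] = #{g ∈ irreduciblesOfDegree K n | g.nextCoeff = a ∧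
      Algebra.trace (ZMod 2) K (g.coeff 1 / g.coeff 0) ≠ 0} := by
  have himage : selfRecipIrredLead K (2 * n) ![a] = reciprocalLift n ''
      ({g ∈ irreduciblesOfDegree K n | g.nextCoeff = a ∧
        Algebra.trace (ZMod 2) K (g.coeff 1 / g.coeff 0) ≠ 0} : Finset K[X]) := by
    ext f
    rw [mem_selfRecipIrredLead_iff, selfRecipIrred_eq_image]
    simp only [Set.mem_image, Finset.mem_coe, Finset.mem_filter, mem_irreduciblesOfDegree,
      Set.mem_ofPred_eq]
    constructor
    · rintro ⟨⟨g, ⟨⟨hmonic, rfl⟩, hirr⟩, rfl⟩, ha⟩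
      have hg := irreducible_of_irreducible_reciprocalLift hmonic hirr
      exact ⟨g, ⟨⟨⟨hmonic, rfl⟩, hg⟩, nextCoeff_reciprocalLift hmonic ▸ ha,
        (irreducible_reciprocalLift_iff_trace_ne_zero hmonic hg).1 hirr⟩, rfl⟩
    · rintro ⟨g, ⟨⟨⟨hmonic, rfl⟩, hg⟩, ha, htrace⟩, rfl⟩
      exact ⟨⟨g, ⟨⟨hmonic, rfl⟩,
        (irreducible_reciprocalLift_iff_trace_ne_zero hmonic hg).2 htrace⟩, rfl⟩,
        (nextCoeff_reciprocalLift hmonic).trans ha⟩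
  rw [numSelfRecip, himage, Set.InjOn.ncard_image, Set.ncard_coe_finset]
  refine (injOn_reciprocalLift n).mono fun g hg => ?_
  exact (mem_irreduciblesOfDegree.1 (Finset.mem_filter.1 hg).1).1.2.le

theorem numSelfRecip_zmod_two (n : ℕ) (a : ZMod 2) :
    numSelfRecip (ZMod 2) n ![a] = #(irreduciblesWithEnds n a 1) := by
  classical
  have hne : ∀ x : ZMod 2, x ≠ 0 ↔ x = 1 := by decide
  rw [numSelfRecip_eq_card, irreduciblesWithEnds]
  congr 1
  ext g
  simp only [Finset.mem_filter, Algebra.trace_self_apply, hne]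

theorem cos_arccos_one_div_two_mul_sqrt_two :
    Real.cos (Real.arccos (1 / (2 * √2))) = 1 / (2 * √2) := by
  have hsqrt : (1 : ℝ) ≤ √2 := Real.one_le_sqrt.2 one_le_two
  refine Real.cos_arccos (neg_one_lt_zero.le.trans (by positivity)) ?_
  rw [div_le_one (by positivity)]
  linarith

theorem two_rpow_mul_cos_eq_of_dvd {n j : ℕ} (hj : j ∈ n.divisors) (θ : ℝ) :
    (2 : ℝ) ^ ((n : ℝ) / (2 * j) + 1) * Real.cos (n * θ / j) =
      2 * √2 ^ (n / j) * Real.cos ((n / j : ℕ) * θ) := by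
  have hj0 : (j : ℝ) ≠ 0 := Nat.cast_ne_zero.2 (Nat.pos_of_mem_divisors hj).ne'
  have hdiv : (n : ℝ) / j = (n / j : ℕ) := (Nat.cast_div (Nat.dvd_of_mem_divisors hj) hj0).symm
  have hpow : (2 : ℝ) ^ ((n : ℝ) / (2 * j)) = √2 ^ (n / j) := by
    rw [mul_comm, ← div_div, hdiv, Real.rpow_div_two_eq_sqrt _ zero_le_two, Real.rpow_natCast]
  rw [Real.rpow_add_one two_ne_zero, hpow, mul_div_right_comm, hdiv, mul_comm (√2 ^ _)]

theorem card_irreduciblesWithEnds {θ : ℝ} (hθ : Real.cos θ = 1 / (2 * √2)) (a : ZMod 2) {n : ℕ}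
    (hn : n ≠ 0) :
    (#(irreduciblesWithEnds n a 1) : ℝ) = 1 / (4 * (n : ℝ)) *
      ∑ j ∈ n.divisors with ¬ 2 ∣ j, (ArithmeticFunction.moebius j : ℝ) * (2 ^ (n / j) -
        (-1) ^ a.val * (1 - 2 * (-√2) ^ (n / j) * Real.cos ((n / j : ℕ) * θ))) := by
  rw [← eq_sum_moebius_mul_of_sum_not_dvd_eq Nat.prime_two
    (f := fun d => 4 * (d * #(irreduciblesWithEnds d a 1) : ℝ))
    (g := fun k => 2 ^ k - (-1) ^ a.val * (1 - 2 * (-√2) ^ k * Real.cos (k * θ)))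
    (fun k hk => by rw [← Finset.mul_sum, sum_mul_card_irreduciblesWithEnds hθ a hk]) hn]
  field_simp

theorem theorem4 (θ : ℝ) (hθ : θ = Real.arccos (1 / (2 * √2))) (n : ℕ) (hn : 1 ≤ n) :
    (numSelfRecip (ZMod 2) n ![1] : ℝ) =
      1 / (4 * (n : ℝ)) * ∑ j ∈ n.divisors with ¬ 2 ∣ j, (ArithmeticFunction.moebius j : ℝ) *
        ((2 : ℝ) ^ (n / j) + 1
          - (-1 : ℝ) ^ (n / j) * (2 : ℝ) ^ ((n : ℝ) / (2 * (j : ℝ)) + 1)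
            * Real.cos ((n : ℝ) * θ / (j : ℝ))) ∧
    (numSelfRecip (ZMod 2) n ![0] : ℝ) =
      1 / (4 * (n : ℝ)) * ∑ j ∈ n.divisors with ¬ 2 ∣ j, (ArithmeticFunction.moebius j : ℝ) *
        ((2 : ℝ) ^ (n / j) - 1
          + (-1 : ℝ) ^ (n / j) * (2 : ℝ) ^ ((n : ℝ) / (2 * (j : ℝ)) + 1)
            * Real.cos ((n : ℝ) * θ / (j : ℝ))) := by
  have hcos : Real.cos θ = 1 / (2 * √2) := hθ ▸ cos_arccos_one_div_two_mul_sqrt_two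
  have hcard (a : ZMod 2) := card_irreduciblesWithEnds hcos a (Nat.one_le_iff_ne_zero.1 hn)
  constructor <;> rw [numSelfRecip_zmod_two, hcard] <;>
    refine congrArg _ (Finset.sum_congr rfl fun j hj => congrArg _ ?_) <;>
    rw [mul_assoc ((-1) ^ _), two_rpow_mul_cos_eq_of_dvd (Finset.mem_filter.1 hj).1, neg_pow √2]
  · rw [ZMod.val_one]
    ring
  · rw [ZMod.val_zero]
    ring
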